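/- Let $\mathcal I\subseteq\mathbb R$ be a nondegenerate interval and let $E,F:\mathcal I\to\mathbb R^{m\times m}$ be continuous. For $\bar t\in\mathcal I$ let $S_{can}(\bar t)\subseteq\mathbb R^m$ be the set of all values $x(\bar t)$ of continuously differentiable solutions $x:(\bar t-\delta,\bar t+\delta)\cap\mathcal I\to\mathbb R^m$, $\delta>0$, of the homogeneous DAE $Ex'+Fx=0$ (the flow subspace). A pair $\{E,F\}$ of size $m$ is called pre-regular with constants $r,\theta$ if, for all $t\in\mathcal I$, $\operatorname{im}[E(t)\;F(t)]=\mathbb R^m$, $\operatorname{rank}E(t)=r$ and $\dim(\ker E(t)\cap S(t))=\theta$, where $S(t)=\{z\in\mathbb R^m: F(t)z\in\operatorname{im}E(t)\}$. The reduction procedure starts from $E_0=E$, $F_0=F$, $m_0=m$; at level $i$, with $r_i=\operatorname{rank}E_i$, it chooses a continuous basis $Y_i:\mathcal I\to\mathbb R^{m_i\times r_i}$ of $\operatorname{im}E_i$ and a continuously differentiable basis $C_i:\mathcal I\to\mathbb R^{m_i\times r_i}$ of $S_i=\{z\in\mathbb R^{m_i}:F_iz\in\operatorname{im}E_i\}$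 and sets $m_{i+1}=r_i$, $$E_{i+1}=Y_i^*E_iC_i,\qquad F_{i+1}=Y_i^*(F_iC_i+E_iC_i').$$ The pair $\{E,F\}$ and the DAE $Ex'+Fx=q$ are called regular on $\mathcal I$ with index $\mu\ge 1$ and characteristics $m>r_0>r_1>\dots>r_{\mu-1}$ and $\theta_0,\dots,\theta_{\mu-1}$ if, for some choice of the bases, the procedure is well defined up to level $\mu-1$, each pair $\{E_i,F_i\}$, $i=0,\dots,\mu-1$, is pre-regular with constants $r_i,\theta_i$, and $E_\mu$ is pointwise nonsingular on $\mathcal I$ (a void condition if $r_{\mu-1}=0$). **Theorem.** Let the DAE be regular on $\mathcal I$ with index $\mu$ and these characteristics, and write $r=r_0$. Then $r_{i+1}=r_i-\theta_i$ for $0\le i\le\mu-2$ and $\theta_0\ge\theta_1\ge\dots\ge\theta_{\mu-2}>\theta_{\mu-1}=0$. For every $t\in\mathcal I$ the flow subspace $S_{can}(t)$ has dimension $$d=r-\sum_{j=0}^{\mu-2}\theta_j=r_{\mu-1}.$$ For every choice of bases $Y_i,C_i$ ($0\le i\le\mu-1$) in the reduction procedure, the matrix function $C=C_0C_1\cdots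 C_{\mu-1}:\mathcal I\to\mathbb R^{m\times d}$ is a basis of $S_{can}$, i.e. for every $t\in\mathcal I$ the columns of $C(t)$ form a basis of $S_{can}(t)$. -/

import Mathlib

open Matrix

noncomputable section

namespace LinearDAE

/-! ### Solutions of the homogeneous equation and the flow subspace -/

/-- `x` is a continuously differentiable solution of `E x' + F x = 0` on the set `J`
(for an interval `J`, the derivative is one-sided at the end points that belong to `J`). -/
def IsSolutionOn {m : ℕ} (E F : ℝ → Matrix (Fin m) (Fin m) ℝ) (J : Set ℝ)
    (x : ℝ → Fin m → ℝ) : Prop :=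
  ∃ x' : ℝ → Fin m → ℝ, ContinuousOn x' J ∧
    ∀ s ∈ J, HasDerivWithinAt x (x' s) J s ∧ E s *ᵥ x' s + F s *ᵥ x s = 0

/-- Solutions restrict to smaller sets. -/
theorem IsSolutionOn.mono {m : ℕ} {E F : ℝ → Matrix (Fin m) (Fin m) ℝ} {J K : Set ℝ}
    {x : ℝ → Fin m → ℝ} (h : IsSolutionOn E F J x) (hK : K ⊆ J) : IsSolutionOn E F K x := by
  obtain ⟨x', hc, hx⟩ := h
  exact ⟨x', hc.mono hK, fun s hs => ⟨(hx s (hK hs)).1.mono hK, (hx s (hK hs)).2⟩⟩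

/-- The flow subspace at time `t`: the set of all values `x t` of solutions of the homogeneous
equation that are defined on `(t - δ, t + δ) ∩ I` for some `δ > 0`. -/
def flowSubspace {m : ℕ} (E F : ℝ → Matrix (Fin m) (Fin m) ℝ) (I : Set ℝ) (t : ℝ) :
    Submodule ℝ (Fin m → ℝ) where
  carrier := {z | ∃ δ : ℝ, 0 < δ ∧ ∃ x : ℝ → Fin m → ℝ,
    IsSolutionOn E F (Set.Ioo (t - δ) (t + δ) ∩ I) x ∧ x t = z}
  zero_mem' := by
    refine ⟨1, one_pos, fun _ => 0, ⟨fun _ => 0, continuousOn_const, fun s _ => ⟨?_, ?_⟩⟩, rfl⟩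
    · exact hasDerivWithinAt_const _ _ _
    · simp
  add_mem' := by
    rintro a b ⟨δ, hδ, x, hx, rfl⟩ ⟨ε, hε, y, hy, rfl⟩
    have h1 : Set.Ioo (t - min δ ε) (t + min δ ε) ∩ I ⊆ Set.Ioo (t - δ) (t + δ) ∩ I := by
      have := min_le_left δ ε
      exact Set.inter_subset_inter_left _ (Set.Ioo_subset_Ioo (by linarith) (by linarith))
    have h2 : Set.Ioo (t - min δ ε) (t + min δ ε) ∩ I ⊆ Set.Ioo (t - ε) (t + ε) ∩ I := by
      have := min_le_right δ ε
      exact Set.inter_subset_inter_left _ (Set.Ioo_subset_Ioo (by linarith) (by linarith))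
    obtain ⟨x', hxc, hx⟩ := hx.mono h1
    obtain ⟨y', hyc, hy⟩ := hy.mono h2
    refine ⟨min δ ε, lt_min hδ hε, fun s => x s + y s, ⟨fun s => x' s + y' s, hxc.add hyc,
      fun s hs => ⟨(hx s hs).1.add (hy s hs).1, ?_⟩⟩, rfl⟩
    rw [mulVec_add, mulVec_add, add_add_add_comm, (hx s hs).2, (hy s hs).2, add_zero]
  smul_mem' := by
    rintro c a ⟨δ, hδ, x, ⟨x', hxc, hx⟩, rfl⟩
    refine ⟨δ, hδ, fun s => c • x s, ⟨fun s => c • x' s, hxc.const_smul c,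
      fun s hs => ⟨(hx s hs).1.const_smul c, ?_⟩⟩, rfl⟩
    rw [mulVec_smul, mulVec_smul, ← smul_add, (hx s hs).2, smul_zero]

/-! ### Pre-regular pairs -/

/-- For constant matrices: `N = ker E`. -/
def kerSpace {m : ℕ} (E : Matrix (Fin m) (Fin m) ℝ) : Submodule ℝ (Fin m → ℝ) :=
  LinearMap.ker E.mulVecLin

/-- For constant matrices: `S = {z | F z ∈ im E}`. -/
def constraintSpace {m : ℕ} (E F : Matrix (Fin m) (Fin m) ℝ) : Submodule ℝ (Fin m → ℝ) :=
  (LinearMap.range E.mulVecLin).comap F.mulVecLin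

/-- The pair `{E, F}` is pre-regular on `I` with constants `r` and `θ`:
`im [E F]` is the whole space, `rank E = r` and `dim (N ∩ S) = θ` at every point of `I`. -/
def IsPreRegular {m : ℕ} (E F : ℝ → Matrix (Fin m) (Fin m) ℝ) (I : Set ℝ) (r θ : ℕ) : Prop :=
  ∀ t ∈ I,
    LinearMap.range (E t).mulVecLin ⊔ LinearMap.range (F t).mulVecLin = ⊤ ∧
    (E t).rank = r ∧
    Module.finrank ℝ ↥(kerSpace (E t) ⊓ constraintSpace (E t) (F t)) = θ

/-! ### The reduction procedure -/

/-- The columns of `B` form a basis of the subspace `W`. -/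
def IsBasisOf {n k : ℕ} (B : Matrix (Fin n) (Fin k) ℝ) (W : Submodule ℝ (Fin n → ℝ)) : Prop :=
  LinearIndependent ℝ B.col ∧ LinearMap.range B.mulVecLin = W

/-- Entrywise derivative of a matrix function relative to the interval `I`. -/
def matDeriv {n k : ℕ} (I : Set ℝ) (C : ℝ → Matrix (Fin n) (Fin k) ℝ) (t : ℝ) :
    Matrix (Fin n) (Fin k) ℝ :=
  Matrix.of fun a b => derivWithin (fun s => C s a b) I t

/-! In the following `m 0, m 1, m 2, …` are the sizes of the successive pairs `{Eᵢ, Fᵢ}`: `m 0` is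
the size of the original pair and `m (i + 1) = rᵢ` is the rank of `Eᵢ`. The bases `Yᵢ` of `im Eᵢ` and
`Cᵢ` of `Sᵢ` have size `m i × m (i + 1)`. Only finitely many of the sizes matter. -/

/-- The pairs produced by the reduction procedure with the bases `Yᵢ`, `Cᵢ`: `{E₀, F₀} = {E, F}`,
`Eᵢ₊₁ = Yᵢ* Eᵢ Cᵢ` and `Fᵢ₊₁ = Yᵢ* (Fᵢ Cᵢ + Eᵢ Cᵢ')`. -/
def stagePair {m : ℕ → ℕ} (E F : ℝ → Matrix (Fin (m 0)) (Fin (m 0)) ℝ) (I : Set ℝ)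
    (Y C : ∀ i, ℝ → Matrix (Fin (m i)) (Fin (m (i + 1))) ℝ) :
    ∀ i, (ℝ → Matrix (Fin (m i)) (Fin (m i)) ℝ) × (ℝ → Matrix (Fin (m i)) (Fin (m i)) ℝ)
  | 0 => (E, F)
  | i + 1 =>
    (fun t => (Y i t)ᵀ * (stagePair E F I Y C i).1 t * C i t,
     fun t => (Y i t)ᵀ * ((stagePair E F I Y C i).2 t * C i t +
        (stagePair E F I Y C i).1 t * matDeriv I (C i) t))

/-- The matrix function `Eᵢ` of the reduction procedure. -/
def stageE {m : ℕ → ℕ} (E F : ℝ → Matrix (Fin (m 0)) (Fin (m 0)) ℝ) (I : Set ℝ)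
    (Y C : ∀ i, ℝ → Matrix (Fin (m i)) (Fin (m (i + 1))) ℝ) (i : ℕ) :
    ℝ → Matrix (Fin (m i)) (Fin (m i)) ℝ :=
  (stagePair E F I Y C i).1

/-- The matrix function `Fᵢ` of the reduction procedure. -/
def stageF {m : ℕ → ℕ} (E F : ℝ → Matrix (Fin (m 0)) (Fin (m 0)) ℝ) (I : Set ℝ)
    (Y C : ∀ i, ℝ → Matrix (Fin (m i)) (Fin (m (i + 1))) ℝ) (i : ℕ) :
    ℝ → Matrix (Fin (m i)) (Fin (m i)) ℝ :=
  (stagePair E F I Y C i).2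

/-- `Yᵢ`, `Cᵢ`, `i = 0, …, μ - 1`, are admissible choices of bases in the first `μ` steps of the
reduction procedure: on `I`, `Yᵢ` is a continuous basis of `im Eᵢ` and `Cᵢ` is a continuously
differentiable basis of `Sᵢ = {z | Fᵢ z ∈ im Eᵢ}`. (The values for `i ≥ μ` are irrelevant.) -/
def IsReduction {m : ℕ → ℕ} (E F : ℝ → Matrix (Fin (m 0)) (Fin (m 0)) ℝ) (I : Set ℝ) (μ : ℕ)
    (Y C : ∀ i, ℝ → Matrix (Fin (m i)) (Fin (m (i + 1))) ℝ) : Prop :=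
  ∀ i < μ,
    ContinuousOn (Y i) I ∧
    (∀ a b, ContDiffOn ℝ 1 (fun t => C i t a b) I) ∧
    ∀ t ∈ I,
      IsBasisOf (Y i t) (LinearMap.range (stageE E F I Y C i t).mulVecLin) ∧
      IsBasisOf (C i t) (constraintSpace (stageE E F I Y C i t) (stageF E F I Y C i t))

/-- The product `C₀ C₁ ⋯ Cₖ₋₁` of the first `k` bases, a matrix function of size `m 0 × m k`. -/
def basisProduct {m : ℕ → ℕ} (C : ∀ i, ℝ → Matrix (Fin (m i)) (Fin (m (i + 1))) ℝ) :
    ∀ k, ℝ → Matrix (Fin (m 0)) (Fin (m k)) ℝ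
  | 0 => fun _ => 1
  | k + 1 => fun t => basisProduct C k t * C k t

/-- The pair `{E, F}` (and the equation `E x' + F x = q`) is regular on `I` with index `μ ≥ 1` and
characteristic values `rᵢ = m (i + 1)`, `m 0 > r₀ > r₁ > ⋯ > r_{μ-1}`, and `θ₀, …, θ_{μ-1}`: for
some choice of the bases the reduction procedure is well defined up to level `μ - 1`, each pair
`{Eᵢ, Fᵢ}`, `i < μ`, is pre-regular with constants `rᵢ`, `θᵢ`, and `E_μ` is pointwise nonsingular.
(If `r_{μ-1} = 0`, the matrix `E_μ` has size zero and the last condition holds trivially.) -/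
def IsRegular {m : ℕ → ℕ} (E F : ℝ → Matrix (Fin (m 0)) (Fin (m 0)) ℝ) (I : Set ℝ) (μ : ℕ)
    (θ : ℕ → ℕ) : Prop :=
  1 ≤ μ ∧ (∀ i < μ, m (i + 1) < m i) ∧
  ∃ Y C : ∀ i, ℝ → Matrix (Fin (m i)) (Fin (m (i + 1))) ℝ,
    IsReduction E F I μ Y C ∧
    (∀ i < μ, IsPreRegular (stageE E F I Y C i) (stageF E F I Y C i) I (m (i + 1)) (θ i)) ∧
    ∀ t ∈ I, IsUnit (stageE E F I Y C μ t).det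

end LinearDAE

end

open Matrix

namespace LinearDAE

/-! ### Calculus of matrix functions -/

/-! A solution x satisfies F x = -E x', so it stays in S = im C and can be written x = C u.
Inserting this and multiplying by Yᵀ, which loses nothing because the residual lies in im E, gives
the reduced DAE for u. Hence C(t) maps the reduced flow subspace onto the original one
(`flowSubspace_eq_map`), and after μ steps S_can is the image under C₀⋯C_{μ-1} of the flow subspace
at level μ. For the regular choice of bases, E_μ is invertible, the last equation is an explicit
linear ODE, and every initial value is attained (`flowSubspace_eq_top`); so dim S_can = m μ.

For any other choice of bases only the inclusion S_can ⊆ im(C₀⋯C_{μ-1}) is needed: the product is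
injective with m μ columns, so dimensions force equality. The relations between r and θ are
rank-nullity at a single point (`rank_reduced_add`, `rank_add_finrank_le`). -/

theorem uniqueDiffOn_of_ordConnected {I : Set ℝ} (hI : I.OrdConnected) (hI' : I.Nontrivial) :
    UniqueDiffOn ℝ I := by
  refine uniqueDiffOn_convex hI.convex ?_
  obtain ⟨a, ha, b, hb, hab⟩ := hI'.exists_lt
  obtain ⟨c, hac, hcb⟩ := exists_between hab
  exact ⟨c, mem_interior.2 ⟨Set.Ioo a b, Set.Ioo_subset_Icc_self.trans (hI.out ha hb),
    isOpen_Ioo, hac, hcb⟩⟩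

theorem hasDerivWithinAt_mulVec {n k : ℕ} {J : Set ℝ} {s : ℝ}
    {C : ℝ → Matrix (Fin n) (Fin k) ℝ} {C' : Matrix (Fin n) (Fin k) ℝ}
    {u : ℝ → Fin k → ℝ} {u' : Fin k → ℝ}
    (hC : ∀ a b, HasDerivWithinAt (fun t => C t a b) (C' a b) J s)
    (hu : HasDerivWithinAt u u' J s) :
    HasDerivWithinAt (fun t => C t *ᵥ u t) (C' *ᵥ u s + C s *ᵥ u') J s := by
  rw [hasDerivWithinAt_pi] at hu ⊢
  intro a
  have := HasDerivWithinAt.fun_sum (u := Finset.univ) fun b _ => (hC a b).mul (hu b)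
  simpa [mulVec, dotProduct, Finset.sum_add_distrib] using this

theorem hasDerivWithinAt_matDeriv {n k : ℕ} {I : Set ℝ} {C : ℝ → Matrix (Fin n) (Fin k) ℝ}
    (hC : ∀ a b, ContDiffOn ℝ 1 (fun t => C t a b) I) {s : ℝ} (hs : s ∈ I) (a : Fin n)
    (b : Fin k) : HasDerivWithinAt (fun t => C t a b) (matDeriv I C s a b) I s :=
  ((hC a b).differentiableOn one_ne_zero s hs).hasDerivWithinAt

theorem continuousOn_matDeriv {n k : ℕ} {I : Set ℝ} (hI : UniqueDiffOn ℝ I)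
    {C : ℝ → Matrix (Fin n) (Fin k) ℝ} (hC : ∀ a b, ContDiffOn ℝ 1 (fun t => C t a b) I) :
    ContinuousOn (matDeriv I C) I :=
  continuousOn_pi.2 fun a => continuousOn_pi.2 fun b =>
    (hC a b).continuousOn_derivWithin hI le_rfl

theorem continuousOn_of_entries {n k : ℕ} {I : Set ℝ}
    {C : ℝ → Matrix (Fin n) (Fin k) ℝ} (hC : ∀ a b, ContDiffOn ℝ 1 (fun t => C t a b) I) :
    ContinuousOn C I :=
  continuousOn_pi.2 fun a => continuousOn_pi.2 fun b => (hC a b).continuousOn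

theorem contDiffOn_mul_entries {n k l : ℕ} {I : Set ℝ} {A : ℝ → Matrix (Fin n) (Fin k) ℝ}
    {B : ℝ → Matrix (Fin k) (Fin l) ℝ} (hA : ∀ a b, ContDiffOn ℝ 1 (fun t => A t a b) I)
    (hB : ∀ a b, ContDiffOn ℝ 1 (fun t => B t a b) I) (a : Fin n) (b : Fin l) :
    ContDiffOn ℝ 1 (fun t => (A t * B t) a b) I := by
  simp only [mul_apply]
  exact ContDiffOn.sum fun c _ => (hA a c).mul (hB c b)

theorem contDiffOn_det {n : ℕ} {I : Set ℝ} {A : ℝ → Matrix (Fin n) (Fin n) ℝ}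
    (hA : ∀ a b, ContDiffOn ℝ 1 (fun t => A t a b) I) :
    ContDiffOn ℝ 1 (fun t => (A t).det) I := by
  simp only [det_apply']
  exact ContDiffOn.sum fun σ _ => contDiffOn_const.mul (contDiffOn_prod fun c _ => hA _ c)

theorem contDiffOn_inv_entries {n : ℕ} {I : Set ℝ} {A : ℝ → Matrix (Fin n) (Fin n) ℝ}
    (hA : ∀ a b, ContDiffOn ℝ 1 (fun t => A t a b) I) (hdet : ∀ t ∈ I, (A t).det ≠ 0)
    (a b : Fin n) : ContDiffOn ℝ 1 (fun t => (A t)⁻¹ a b) I := by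
  -- Cramer's rule: each entry of the inverse is a quotient of determinants, hence as smooth as the
  -- entries of A.
  have : ∀ t, (A t)⁻¹ a b = ((A t).det)⁻¹ * ((A t).updateRow b (Pi.single a 1)).det := by
    intro t
    rw [inv_def, Ring.inverse_eq_inv', Matrix.smul_apply, adjugate_apply, smul_eq_mul]
  simp only [this]
  refine ((contDiffOn_det hA).inv hdet).mul (contDiffOn_det fun c d => ?_)
  by_cases h : c = b
  · subst h
    simpa using contDiffOn_const
  · simpa [updateRow_ne h] using hA c d

theorem continuousOn_inv {n : ℕ} {I : Set ℝ} {A : ℝ → Matrix (Fin n) (Fin n) ℝ}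
    (hA : ContinuousOn A I) (hdet : ∀ t ∈ I, (A t).det ≠ 0) :
    ContinuousOn (fun t => (A t)⁻¹) I := by
  simp only [inv_def, Ring.inverse_eq_inv']
  exact (((continuous_id.matrix_det).comp_continuousOn hA).inv₀ hdet).smul
    ((continuous_id.matrix_adjugate).comp_continuousOn hA)

theorem continuousOn_mulVec {n k : ℕ} {J : Set ℝ} {C : ℝ → Matrix (Fin n) (Fin k) ℝ}
    {u : ℝ → Fin k → ℝ} (hC : ContinuousOn C J) (hu : ContinuousOn u J) :
    ContinuousOn (fun t => C t *ᵥ u t) J :=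
  (continuous_fst.matrix_mulVec continuous_snd).comp_continuousOn (hC.prodMk hu)

/-! ### Bases of subspaces -/

theorem IsBasisOf.injective {n k : ℕ} {B : Matrix (Fin n) (Fin k) ℝ}
    {W : Submodule ℝ (Fin n → ℝ)} (h : IsBasisOf B W) : Function.Injective B.mulVecLin :=
  mulVec_injective_iff.2 h.1

theorem isBasisOf_iff {n k : ℕ} {B : Matrix (Fin n) (Fin k) ℝ} {W : Submodule ℝ (Fin n → ℝ)} :
    IsBasisOf B W ↔ Function.Injective B.mulVecLin ∧ LinearMap.range B.mulVecLin = W :=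
  and_congr_left fun _ => mulVec_injective_iff.symm

/-- The transpose of a basis of `W` is injective on `W`. -/
theorem IsBasisOf.eq_zero_of_transpose_mulVec {n k : ℕ} {B : Matrix (Fin n) (Fin k) ℝ}
    {W : Submodule ℝ (Fin n → ℝ)} (h : IsBasisOf B W) {w : Fin n → ℝ} (hw : w ∈ W)
    (h0 : Bᵀ *ᵥ w = 0) : w = 0 := by
  rw [← h.2] at hw
  obtain ⟨v, rfl⟩ := hw
  -- Over ℝ, BᵀB and B have the same kernel.
  have : v ∈ LinearMap.ker (Bᵀ * B).mulVecLin := by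
    rw [LinearMap.mem_ker, mulVecLin_mul]
    exact h0
  rw [ker_mulVecLin_transpose_mul_self] at this
  exact this

theorem IsBasisOf.det_gram_ne_zero {n k : ℕ} {B : Matrix (Fin n) (Fin k) ℝ}
    {W : Submodule ℝ (Fin n → ℝ)} (h : IsBasisOf B W) : (Bᵀ * B).det ≠ 0 := by
  rw [← isUnit_iff_ne_zero, ← isUnit_iff_isUnit_det, ← mulVec_injective_iff_isUnit]
  change Function.Injective (Bᵀ * B).mulVecLin
  rw [← LinearMap.ker_eq_bot, ker_mulVecLin_transpose_mul_self, LinearMap.ker_eq_bot]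
  exact h.injective

/-! ### One step of the reduction -/

/-- `C u` satisfies the DAE pointwise exactly if `u` satisfies the reduced one. -/
theorem mulVec_reduced_eq_zero_iff {n k : ℕ} {E F : Matrix (Fin n) (Fin n) ℝ}
    {Y C C' : Matrix (Fin n) (Fin k) ℝ}
    (hY : IsBasisOf Y (LinearMap.range E.mulVecLin))
    (hC : IsBasisOf C (constraintSpace E F)) (u u' : Fin k → ℝ) :
    (Yᵀ * E * C) *ᵥ u' + (Yᵀ * (F * C + E * C')) *ᵥ u = 0 ↔
      E *ᵥ (C' *ᵥ u + C *ᵥ u') + F *ᵥ (C *ᵥ u) = 0 := by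
  have key : (Yᵀ * E * C) *ᵥ u' + (Yᵀ * (F * C + E * C')) *ᵥ u =
      Yᵀ *ᵥ (E *ᵥ (C' *ᵥ u + C *ᵥ u') + F *ᵥ (C *ᵥ u)) := by
    simp only [← mulVec_mulVec, mulVec_add, add_mulVec]
    abel
  rw [key]
  -- Since C u ∈ S, the whole residual lies in im E, where Yᵀ is injective.
  refine ⟨fun h => hY.eq_zero_of_transpose_mulVec (add_mem ⟨_, rfl⟩ ?_) h, fun h => ?_⟩
  · have : C *ᵥ u ∈ constraintSpace E F := hC.2 ▸ ⟨u, rfl⟩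
    exact this
  · rw [h, mulVec_zero]

/-- Solutions x of the DAE and u of the reduced DAE correspond through x = C u. Since C is C¹ with
independent columns, it has a C¹ left inverse, so u inherits the smoothness of x. -/
theorem flowSubspace_eq_map {n k : ℕ} {I : Set ℝ} (hI : UniqueDiffOn ℝ I)
    {E F : ℝ → Matrix (Fin n) (Fin n) ℝ} {Y C : ℝ → Matrix (Fin n) (Fin k) ℝ}
    (hC : ∀ a b, ContDiffOn ℝ 1 (fun t => C t a b) I)
    (hY : ∀ t ∈ I, IsBasisOf (Y t) (LinearMap.range (E t).mulVecLin))
    (hS : ∀ t ∈ I, IsBasisOf (C t) (constraintSpace (E t) (F t))) {t : ℝ} (ht : t ∈ I) :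
    flowSubspace E F I t = (flowSubspace (fun t => (Y t)ᵀ * E t * C t)
      (fun t => (Y t)ᵀ * (F t * C t + E t * matDeriv I C t)) I t).map (C t).mulVecLin := by
  have hsub : ∀ δ, Set.Ioo (t - δ) (t + δ) ∩ I ⊆ I := fun δ => Set.inter_subset_right
  have hC' := continuousOn_matDeriv hI hC
  ext z
  constructor
  · rintro ⟨δ, hδ, x, ⟨x', hx'c, hx⟩, rfl⟩
    set J := Set.Ioo (t - δ) (t + δ) ∩ I with hJ
    have hJu : UniqueDiffOn ℝ J := by
      rw [hJ, Set.inter_comm]; exact hI.inter isOpen_Ioo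
    have htJ : t ∈ J := ⟨⟨by linarith, by linarith⟩, ht⟩
    -- The Moore-Penrose left inverse of C.
    let G : ℝ → Matrix (Fin k) (Fin n) ℝ := fun s => ((C s)ᵀ * C s)⁻¹ * (C s)ᵀ
    have hG : ∀ a b, ContDiffOn ℝ 1 (fun s => G s a b) I :=
      contDiffOn_mul_entries (contDiffOn_inv_entries
        (contDiffOn_mul_entries (fun a b => hC b a) hC)
        fun s hs => (hS s hs).det_gram_ne_zero) fun a b => hC b a
    have hGC : ∀ s ∈ I, G s * C s = 1 := fun s hs => by
      simp only [G, Matrix.mul_assoc]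
      exact nonsing_inv_mul _ (isUnit_iff_ne_zero.2 (hS s hs).det_gram_ne_zero)
    have hxS : ∀ s ∈ J, C s *ᵥ (G s *ᵥ x s) = x s := by
      intro s hs
      have : x s ∈ constraintSpace (E s) (F s) := by
        refine ⟨-x' s, ?_⟩
        simp only [mulVecLin_apply, mulVec_neg]
        exact neg_eq_of_add_eq_zero_right (hx s hs).2
      rw [← (hS s hs.2).2] at this
      obtain ⟨v, hv⟩ := this
      simp only [mulVecLin_apply] at hv
      rw [← hv, mulVec_mulVec v (G s), hGC s hs.2, one_mulVec]
    have hxc : ContinuousOn x J := fun s hs => (hx s hs).1.continuousWithinAt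
    have hu : ∀ s ∈ J, HasDerivWithinAt (fun s => G s *ᵥ x s)
        (matDeriv I G s *ᵥ x s + G s *ᵥ x' s) J s := fun s hs =>
      hasDerivWithinAt_mulVec
        (fun a b => (hasDerivWithinAt_matDeriv hG hs.2 a b).mono (hsub δ)) (hx s hs).1
    refine ⟨G t *ᵥ x t, ⟨δ, hδ, fun s => G s *ᵥ x s,
      ⟨fun s => matDeriv I G s *ᵥ x s + G s *ᵥ x' s, ?_, fun s hs => ⟨hu s hs, ?_⟩⟩, rfl⟩,
      hxS t htJ⟩
    · exact (continuousOn_mulVec ((continuousOn_matDeriv hI hG).mono (hsub δ)) hxc).add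
        (continuousOn_mulVec ((continuousOn_of_entries hG).mono (hsub δ)) hx'c)
    · have h1 := hasDerivWithinAt_mulVec
        (fun a b => (hasDerivWithinAt_matDeriv hC hs.2 a b).mono (hsub δ)) (hu s hs)
      -- Uniqueness of one-sided derivatives identifies x' with C'u + C u'.
      have h2 := (hJu s hs).eq_deriv _ (h1.congr (fun y hy => (hxS y hy).symm) (hxS s hs).symm)
        (hx s hs).1
      rw [mulVec_reduced_eq_zero_iff (hY s hs.2) (hS s hs.2), h2, hxS s hs]
      exact (hx s hs).2
  · rintro ⟨_, ⟨δ, hδ, u, ⟨u', hu'c, hu⟩, rfl⟩, rfl⟩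
    have huc : ContinuousOn u (Set.Ioo (t - δ) (t + δ) ∩ I) :=
      fun s hs => (hu s hs).1.continuousWithinAt
    refine ⟨δ, hδ, fun s => C s *ᵥ u s, ⟨fun s => matDeriv I C s *ᵥ u s + C s *ᵥ u' s, ?_,
      fun s hs => ⟨?_, ?_⟩⟩, rfl⟩
    · exact (continuousOn_mulVec (hC'.mono (hsub δ)) huc).add
        (continuousOn_mulVec ((continuousOn_of_entries hC).mono (hsub δ)) hu'c)
    · exact hasDerivWithinAt_mulVec
        (fun a b => (hasDerivWithinAt_matDeriv hC hs.2 a b).mono (hsub δ)) (hu s hs).1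
    · exact (mulVec_reduced_eq_zero_iff (hY s hs.2) (hS s hs.2) _ _).1 (hu s hs).2

/-- The rank drops by `dim (ker E ∩ S)` in one step of the reduction. -/
theorem rank_reduced_add {n k : ℕ} {E F : Matrix (Fin n) (Fin n) ℝ}
    {Y C : Matrix (Fin n) (Fin k) ℝ}
    (hY : IsBasisOf Y (LinearMap.range E.mulVecLin))
    (hC : IsBasisOf C (constraintSpace E F)) :
    (Yᵀ * E * C).rank + Module.finrank ℝ ↥(kerSpace E ⊓ constraintSpace E F) = k := by
  have hker : LinearMap.ker (Yᵀ * E * C).mulVecLin = LinearMap.ker (E * C).mulVecLin := by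
    ext v
    simp only [LinearMap.mem_ker, mulVecLin_apply, ← mulVec_mulVec]
    exact ⟨fun h => hY.eq_zero_of_transpose_mulVec ⟨_, rfl⟩ h, fun h => by rw [h, mulVec_zero]⟩
  -- C is injective with image S, so ker(EC) is a copy of ker E ∩ S.
  have hmap : (LinearMap.ker (E * C).mulVecLin).map C.mulVecLin =
      kerSpace E ⊓ constraintSpace E F := by
    rw [mulVecLin_mul, LinearMap.ker_comp, Submodule.map_comap_eq, hC.2, inf_comm]
    rfl
  have h := (Yᵀ * E * C).mulVecLin.finrank_range_add_finrank_ker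
  rw [hker, Module.finrank_fin_fun] at h
  rw [← hmap, ← (Submodule.equivMapOfInjective _ hC.injective _).finrank_eq]
  exact h

theorem rank_add_finrank_le {n : ℕ} (E F : Matrix (Fin n) (Fin n) ℝ) :
    E.rank + Module.finrank ℝ ↥(kerSpace E ⊓ constraintSpace E F) ≤ n := by
  have h := E.mulVecLin.finrank_range_add_finrank_ker
  rw [Module.finrank_fin_fun] at h
  exact (Nat.add_le_add_left (Submodule.finrank_mono inf_le_left) _).trans_eq h

/-! ### Implicitly given regular differential equations -/

/-- An interval contains small compact intervals that are relative neighbourhoods. -/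
theorem exists_Icc_subset_ordConnected {I : Set ℝ} (hI : I.OrdConnected) {t : ℝ} (ht : t ∈ I)
    {ε : ℝ} (hε : 0 < ε) : ∃ a b, t ∈ Set.Icc a b ∧ Set.Icc a b ⊆ I ∧
      t - ε ≤ a ∧ b ≤ t + ε ∧ ∃ δ > 0, Set.Ioo (t - δ) (t + δ) ∩ I ⊆ Set.Icc a b := by
  obtain ⟨a, haI, hat, ha, δ₁, hδ₁, h1⟩ : ∃ a ∈ I, a ≤ t ∧ t - ε ≤ a ∧ ∃ δ > 0,
      ∀ s ∈ I, t - δ < s → a ≤ s := by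
    -- If t is the left end point of I, take a = t; any δ then works.
    by_cases h : ∃ s ∈ I, s < t
    · obtain ⟨s, hs, hst⟩ := h
      have hlt : max s (t - ε) < t := max_lt hst (by linarith)
      exact ⟨max s (t - ε), hI.out hs ht ⟨le_max_left _ _, hlt.le⟩, hlt.le, le_max_right _ _,
        t - max s (t - ε), sub_pos.2 hlt, fun y _ hy => by linarith⟩
    · push Not at h
      exact ⟨t, ht, le_rfl, by linarith, 1, one_pos, fun s hs _ => h s hs⟩
  obtain ⟨b, hbI, hbt, hb, δ₂, hδ₂, h2⟩ : ∃ b ∈ I, t ≤ b ∧ b ≤ t + ε ∧ ∃ δ > 0,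
      ∀ s ∈ I, s < t + δ → s ≤ b := by
    by_cases h : ∃ s ∈ I, t < s
    · obtain ⟨s, hs, hst⟩ := h
      have hlt : t < min s (t + ε) := lt_min hst (by linarith)
      exact ⟨min s (t + ε), hI.out ht hs ⟨hlt.le, min_le_left _ _⟩, hlt.le, min_le_right _ _,
        min s (t + ε) - t, sub_pos.2 hlt, fun y _ hy => by linarith⟩
    · push Not at h
      exact ⟨t, ht, le_rfl, by linarith, 1, one_pos, fun s hs _ => h s hs⟩
  refine ⟨a, b, ⟨hat, hbt⟩, hI.out haI hbI, ha, hb, min δ₁ δ₂, lt_min hδ₁ hδ₂, fun s hs => ?_⟩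
  have := min_le_left δ₁ δ₂
  have := min_le_right δ₁ δ₂
  exact ⟨h1 s hs.2 (by linarith [hs.1.1]), h2 s hs.2 (by linarith [hs.1.2])⟩

/-- Local solvability of linear initial value problems on an interval. -/
theorem exists_local_solution {n : ℕ} {I : Set ℝ} (hI : I.OrdConnected)
    {A : ℝ → Matrix (Fin n) (Fin n) ℝ} (hA : ContinuousOn A I) {t : ℝ} (ht : t ∈ I)
    (z : Fin n → ℝ) : ∃ δ > 0, ∃ u : ℝ → Fin n → ℝ, u t = z ∧
      ∀ s ∈ Set.Ioo (t - δ) (t + δ) ∩ I,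
        HasDerivWithinAt u (A s *ᵥ u s) (Set.Ioo (t - δ) (t + δ) ∩ I) s := by
  let Φ : Matrix (Fin n) (Fin n) ℝ →ₗ[ℝ] ((Fin n → ℝ) →L[ℝ] (Fin n → ℝ)) :=
    LinearMap.toContinuousLinearMap.toLinearMap ∘ₗ (toLin').toLinearMap
  have hΦ : ContinuousOn (fun s => Φ (A s)) I :=
    Φ.continuous_of_finiteDimensional.comp_continuousOn hA
  have hΦA : ∀ s v, Φ (A s) v = A s *ᵥ v := fun s v => rfl
  obtain ⟨ε, hε, hb⟩ : ∃ ε > 0, ∀ s ∈ I, |s - t| < ε → ‖Φ (A s)‖ ≤ ‖Φ (A t)‖ + 1 := by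
    obtain ⟨ε, hε, h⟩ := Metric.continuousWithinAt_iff.1 (hΦ t ht) 1 one_pos
    refine ⟨ε, hε, fun s hs hst => ?_⟩
    have h1 := h hs hst
    rw [dist_eq_norm] at h1
    have := norm_sub_norm_le (Φ (A s)) (Φ (A t))
    linarith
  -- K is a Lipschitz constant near t and L bounds the vector field on the unit ball around z; a
  -- time radius of at most 1/L keeps the Picard iteration in that ball.
  let K : NNReal := ⟨‖Φ (A t)‖ + 1, by positivity⟩
  let L : NNReal := K * (‖z‖₊ + 1)
  have hL : 0 < (L : ℝ) := by
    have h1 : 0 < (K : ℝ) := add_pos_of_nonneg_of_pos (norm_nonneg (Φ (A t))) one_pos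
    have h2 : 0 < ‖z‖ + 1 := by positivity
    exact mul_pos h1 h2
  obtain ⟨a, b, htab, hab, ha, hb', δ, hδ, hδI⟩ := exists_Icc_subset_ordConnected hI ht
    (lt_min (half_pos hε) (inv_pos.2 hL))
  have hm1 := min_le_left (ε / 2) (L : ℝ)⁻¹
  have hm2 := min_le_right (ε / 2) (L : ℝ)⁻¹
  have hK : ∀ s ∈ Set.Icc a b, ‖Φ (A s)‖₊ ≤ K := fun s hs =>
    hb s (hab hs) (abs_lt.2 ⟨by linarith [hs.1], by linarith [hs.2]⟩)
  have hPL : IsPicardLindelof (fun s v => Φ (A s) v) (⟨t, htab⟩ : Set.Icc a b) z 1 0 L K :=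
    { lipschitzOnWith := fun s hs => ((Φ (A s)).lipschitz.weaken (hK s hs)).lipschitzOnWith
      continuousOn := fun v _ => (hΦ.mono hab).clm_apply continuousOn_const
      norm_le := fun s hs v hv => by
        refine ((Φ (A s)).le_opNorm v).trans ?_
        have h1 : ‖v‖ ≤ ‖z‖ + 1 := by
          have := norm_le_norm_add_norm_sub' v z
          have h2 := mem_closedBall_iff_norm.1 hv
          have h3 : ((1 : NNReal) : ℝ) = 1 := rfl
          linarith
        exact mul_le_mul (hK s hs) h1 (norm_nonneg _) K.2
      mul_max_le := by
        have : max (b - t) (t - a) ≤ (L : ℝ)⁻¹ := max_le (by linarith) (by linarith)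
        calc (L : ℝ) * max (b - t) (t - a) ≤ L * (L : ℝ)⁻¹ := by gcongr
          _ = ((1 : NNReal) : ℝ) - (0 : NNReal) := by
            rw [mul_inv_cancel₀ hL.ne']; simp }
  obtain ⟨u, hu0, hu⟩ := hPL.exists_eq_forall_mem_Icc_hasDerivWithinAt₀
  exact ⟨δ, hδ, u, hu0, fun s hs => (hu s (hδI hs)).mono hδI⟩

theorem flowSubspace_eq_top {n : ℕ} {I : Set ℝ} (hI : I.OrdConnected)
    {E F : ℝ → Matrix (Fin n) (Fin n) ℝ} (hE : ContinuousOn E I) (hF : ContinuousOn F I)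
    (hdet : ∀ t ∈ I, IsUnit (E t).det) {t : ℝ} (ht : t ∈ I) : flowSubspace E F I t = ⊤ := by
  refine eq_top_iff.2 fun z _ => ?_
  let A : ℝ → Matrix (Fin n) (Fin n) ℝ := fun s => -((E s)⁻¹ * F s)
  have hA : ContinuousOn A I := by
    have h := continuousOn_inv hE fun s hs => (hdet s hs).ne_zero
    exact ((continuous_fst.matrix_mul continuous_snd).comp_continuousOn (h.prodMk hF)).neg
  obtain ⟨δ, hδ, u, hu0, hu⟩ := exists_local_solution hI hA ht z
  refine ⟨δ, hδ, u, ⟨fun s => A s *ᵥ u s, ?_, fun s hs => ⟨hu s hs, ?_⟩⟩, hu0⟩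
  · exact continuousOn_mulVec (hA.mono Set.inter_subset_right)
      fun s hs => (hu s hs).continuousWithinAt
  · rw [mulVec_mulVec, Matrix.mul_neg, mul_nonsing_inv_cancel_left _ _ (hdet s hs.2), neg_mulVec,
      neg_add_cancel]

/-! ### The whole reduction procedure -/

section Procedure

variable {m : ℕ → ℕ} {E F : ℝ → Matrix (Fin (m 0)) (Fin (m 0)) ℝ} {I : Set ℝ} {μ : ℕ}
  {Y C : ∀ i, ℝ → Matrix (Fin (m i)) (Fin (m (i + 1))) ℝ}

theorem continuousOn_stage (hI : UniqueDiffOn ℝ I) (hE : ContinuousOn E I)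
    (hF : ContinuousOn F I) (h : IsReduction E F I μ Y C) :
    ∀ i ≤ μ, ContinuousOn (stageE E F I Y C i) I ∧ ContinuousOn (stageF E F I Y C i) I := by
  have hmul : ∀ {p q l : ℕ} {A : ℝ → Matrix (Fin p) (Fin q) ℝ} {B : ℝ → Matrix (Fin q) (Fin l) ℝ},
      ContinuousOn A I → ContinuousOn B I → ContinuousOn (fun t => A t * B t) I :=
    fun hA hB => (continuous_fst.matrix_mul continuous_snd).comp_continuousOn (hA.prodMk hB)
  intro i
  induction i with
  | zero => exact fun _ => ⟨hE, hF⟩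
  | succ i ih =>
    intro hi
    obtain ⟨h1, h2⟩ := ih (by omega)
    obtain ⟨hY, hC, -⟩ := h i (by omega)
    have hYT : ContinuousOn (fun t => (Y i t)ᵀ) I :=
      continuous_id.matrix_transpose.comp_continuousOn hY
    have hCc := continuousOn_of_entries hC
    exact ⟨hmul (hmul hYT h1) hCc,
      hmul hYT ((hmul h2 hCc).add (hmul h1 (continuousOn_matDeriv hI hC)))⟩

theorem basisProduct_injective (h : IsReduction E F I μ Y C) {t : ℝ} (ht : t ∈ I) :
    ∀ i ≤ μ, Function.Injective (basisProduct C i t).mulVecLin := by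
  intro i
  induction i with
  | zero =>
    intro _
    simp only [basisProduct, mulVecLin_one]
    exact Function.injective_id
  | succ i ih =>
    intro hi
    simp only [basisProduct, mulVecLin_mul]
    exact (ih (by omega)).comp ((h i (by omega)).2.2 t ht).2.injective

theorem flowSubspace_eq_map_basisProduct (hI : UniqueDiffOn ℝ I) (h : IsReduction E F I μ Y C)
    {t : ℝ} (ht : t ∈ I) : ∀ i ≤ μ, flowSubspace E F I t =
      (flowSubspace (stageE E F I Y C i) (stageF E F I Y C i) I t).map
        (basisProduct C i t).mulVecLin := by
  intro i
  induction i with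
  | zero =>
    intro _
    simp only [basisProduct, mulVecLin_one, Submodule.map_id]
    rfl
  | succ i ih =>
    intro hi
    obtain ⟨-, hC, hb⟩ := h i (by omega)
    rw [ih (by omega), flowSubspace_eq_map hI hC (fun s hs => (hb s hs).1)
      (fun s hs => (hb s hs).2) ht, ← Submodule.map_comp, ← mulVecLin_mul]
    rfl

end Procedure

end LinearDAE

theorem theorem3p4 {m : ℕ → ℕ} (I : Set ℝ) (hI : I.OrdConnected) (hI' : I.Nontrivial)
    (E F : ℝ → Matrix (Fin (m 0)) (Fin (m 0)) ℝ) (hE : ContinuousOn E I) (hF : ContinuousOn F I)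
    (μ : ℕ) (r θ : ℕ → ℕ) (hr : ∀ i, r i = m (i + 1))
    (hreg : LinearDAE.IsRegular E F I μ θ) :
    -- the two systems of characteristic values determine each other
    ((∀ i, i + 1 < μ → r (i + 1) + θ i = r i ∧ θ (i + 1) ≤ θ i ∧ 0 < θ i) ∧ θ (μ - 1) = 0) ∧
    -- the flow subspace has the constant dimension `d = r₀ - ∑ θⱼ = r_{μ-1}`
    (∀ t ∈ I, Module.finrank ℝ (LinearDAE.flowSubspace E F I t) = r (μ - 1)) ∧
    ((r (μ - 1) : ℤ) = (r 0 : ℤ) - ∑ j ∈ Finset.range (μ - 1), (θ j : ℤ)) ∧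
    -- every choice of bases in the reduction procedure yields a basis `C₀ ⋯ C_{μ-1}` of it
    (∀ Y C : ∀ i, ℝ → Matrix (Fin (m i)) (Fin (m (i + 1))) ℝ,
      LinearDAE.IsReduction E F I μ Y C →
      ∀ t ∈ I, LinearDAE.IsBasisOf (LinearDAE.basisProduct C μ t)
        (LinearDAE.flowSubspace E F I t)) := by
  obtain ⟨hμ, hlt, Y, C, hred, hpre, hdet⟩ := hreg
  have hIu := LinearDAE.uniqueDiffOn_of_ordConnected hI hI'
  obtain ⟨t₀, ht₀⟩ := hI'.nonempty
  have hstep : ∀ i < μ, (LinearDAE.stageE E F I Y C (i + 1) t₀).rank + θ i = m (i + 1) := by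
    intro i hi
    rw [← (hpre i hi t₀ ht₀).2.2]
    exact LinearDAE.rank_reduced_add ((hred i hi).2.2 t₀ ht₀).1 ((hred i hi).2.2 t₀ ht₀).2
  have hdrop : ∀ i, i + 1 < μ → m (i + 1 + 1) + θ i = m (i + 1) := by
    intro i hi
    -- Pre-regularity is available only below level μ, hence the bound i + 1 < μ.
    rw [← hstep i (by omega), (hpre (i + 1) hi t₀ ht₀).2.1]
  have hlast : μ - 1 + 1 = μ := by omega
  have hdim : ∀ t ∈ I, Module.finrank ℝ (LinearDAE.flowSubspace E F I t) = m μ := by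
    intro t ht
    have hc := LinearDAE.continuousOn_stage hIu hE hF hred μ le_rfl
    rw [LinearDAE.flowSubspace_eq_map_basisProduct hIu hred ht μ le_rfl,
      LinearDAE.flowSubspace_eq_top hI hc.1 hc.2 hdet ht,
      ← (Submodule.equivMapOfInjective _
        (LinearDAE.basisProduct_injective hred ht μ le_rfl) _).finrank_eq,
      finrank_top, Module.finrank_fin_fun]
  refine ⟨⟨fun i hi => ?_, ?_⟩, fun t ht => ?_, ?_, fun Y' C' hred' t ht => ?_⟩
  · have h1 := hdrop i hi
    have h2 : m (i + 1 + 1) < m (i + 1) := hlt (i + 1) hi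
    -- Rank-nullity at level i + 1 gives r_{i+1} + θ_{i+1} ≤ r_i = r_{i+1} + θ_i.
    have h3 : θ (i + 1) ≤ θ i := by
      have hle := LinearDAE.rank_add_finrank_le (LinearDAE.stageE E F I Y C (i + 1) t₀)
        (LinearDAE.stageF E F I Y C (i + 1) t₀)
      rw [(hpre (i + 1) hi t₀ ht₀).2.1, (hpre (i + 1) hi t₀ ht₀).2.2] at hle
      omega
    rw [hr, hr]
    exact ⟨h1, h3, by omega⟩
  · have h := hstep (μ - 1) (by omega)
    rw [rank_of_isUnit, Fintype.card_fin] at h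
    · omega
    · rw [isUnit_iff_isUnit_det, hlast]
      exact hdet t₀ ht₀
  · rw [hr, hlast]
    exact hdim t ht
  · have hsum : ∀ k, k + 1 ≤ μ →
        (m (k + 1) : ℤ) = (m 1 : ℤ) - ∑ j ∈ Finset.range k, (θ j : ℤ) := by
      intro k
      induction k with
      | zero => simp
      | succ k ih =>
        intro hk
        have h1 := hdrop k (by omega)
        have h2 := ih (by omega)
        rw [Finset.sum_range_succ]
        push_cast [← h1] at h2
        linarith
    rw [hr, hr]
    exact hsum (μ - 1) (by omega)
  · have hinj := LinearDAE.basisProduct_injective hred' ht μ le_rfl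
    have hmap := LinearDAE.flowSubspace_eq_map_basisProduct hIu hred' ht μ le_rfl
    -- Nonsingularity of E_μ for the new bases is not needed: the dimension is already known from
    -- the regular choice.
    have hle : LinearDAE.flowSubspace E F I t ≤
        LinearMap.range (LinearDAE.basisProduct C' μ t).mulVecLin :=
      hmap.trans_le LinearMap.map_le_range
    refine LinearDAE.isBasisOf_iff.2 ⟨hinj, (Submodule.eq_of_le_of_finrank_eq hle ?_).symm⟩
    rw [hdim t ht, LinearMap.finrank_range_of_inj hinj, Module.finrank_fin_fun]
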